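/- Conventions. $\ell^\infty$ is the space of bounded real sequences with the supremum norm $|\cdot|$, and $B(x,r)$ is the open ball in it; $B_X(x,r)$ is the open ball of a metric space $X$; $\dim$ is Hausdorff dimension. For $X\subseteq \ell^\infty$, $x\in X$ and $r>0$ put $$\beta'_X(x,r)=\inf_{s}\frac{\ell(s)-|s(0)-s(1)|+\sup_{z\in X\cap B(x,r)}\operatorname{dist}(z,s([0,1]))}{|s(0)-s(1)|},$$ where the infimum is over all continuous curves $s:[0,1]\to B(x,r)\subseteq\ell^\infty$ with $s(0)\ne s(1)$, and $\ell(s)\in[0,\infty]$ is the length of $s$. Let $Y=[0,e_1]\cup[0,e_2]\cup[0,e_3]\subseteq\mathbb R^3$, where $e_1,e_2,e_3$ is the standard basis. For a metric space $X$, $c>0$, $x\in X$ and $r>0$, the ball $B_X(x,r)$ has a $c$-antenna if there is a homeomorphism $h:Y\to h(Y)\subseteq B_X(x,r)$ such that the distance between $h(e_i)$ and $h([0,e_j]\cup[0,e_k])$ is at least $cr$ for all permutations $(i,j,k)$ of $(1,2,3)$. A compact connected metric space $X$ is $c$-antenna-like if $B_X(x,r)$ has a $c$-antenna for every $x\in X$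 and $0<r<\frac12\operatorname{diam}X$, and antenna-like if it is $c$-antenna-like for some $c>0$. A map $f:X\to Z$ of metric spaces is quasisymmetric if it is injective and there is an increasing homeomorphism $\eta:(0,\infty)\to(0,\infty)$ such that $\frac{d(f(x),f(y))}{d(f(z),f(y))}\le\eta\!\left(\frac{d(x,y)}{d(z,y)}\right)$ for all distinct $x,y,z\in X$. Theorem 1.5. (1) Let $X\subseteq\ell^\infty$ be compact and connected, $c>0$, $x\in X$, $r>0$. If $B_X(x,r)$ has a $c$-antenna, then $\beta'_X(x,r)>\frac c7$. Moreover, there is a universal constant $c_0>0$ such that every compact connected metric space $X$ with more than one point that is $c$-antenna-like for some $c>0$ satisfies $\dim X\ge 1+\frac{c_0}{49}c^2$. (2) If $X$ is a compact connected antenna-like metric space and $f$ is a quasisymmetric map from $X$ into any metric space, then $f(X)$ is a compact connected antenna-like metric space; and if $X$ has more than one point, then $\dim f(X)>1$. -/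

import Mathlib

open Set Metric Topology
open scoped ENNReal

universe u v

noncomputable section

/-- The sequence space `ℓ^∞` of bounded real sequences with the supremum norm. -/
abbrev EllInfty : Type := lp (fun _ : ℕ => ℝ) ∞

/-- The geodesic deviation `β'_X(x,r)` of a set `X ⊆ ℓ^∞` in the ball `B(x,r)`: the infimum of
`(ℓ(s) - |s(0) - s(1)| + sup_{z ∈ X ∩ B(x,r)} dist(z, s([0,1]))) / |s(0) - s(1)|`
over all curves `s : [0,1] → B(x,r) ⊆ ℓ^∞` with `s(0) ≠ s(1)` (so that the quotient makes sense).
It takes values in `[0,∞]`; a curve of infinite length contributes `∞`. The length `ℓ(s)` is the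
total variation of `s`, which is at least `|s(0) - s(1)|`, so the subtraction does not truncate. -/
def betaPrime (X : Set EllInfty) (x : EllInfty) (r : ℝ) : ℝ≥0∞ :=
  ⨅ (s : C(unitInterval, EllInfty)) (_ : ∀ t, s t ∈ ball x r) (_ : s 0 ≠ s 1),
    (eVariationOn s univ - edist (s 0) (s 1) + ⨆ z ∈ X ∩ ball x r, infEDist z (range s))
      / edist (s 0) (s 1)

/-- The `i`-th standard basis vector `e_i` of `ℝ³`. -/
def tip (i : Fin 3) : EuclideanSpace ℝ (Fin 3) := EuclideanSpace.single i 1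

/-- The segment `[0, e_i]` in `ℝ³`. -/
def leg (i : Fin 3) : Set (EuclideanSpace ℝ (Fin 3)) := segment ℝ 0 (tip i)

/-- The tripod `[0,e₁] ∪ [0,e₂] ∪ [0,e₃]` in `ℝ³`. -/
def tripod : Set (EuclideanSpace ℝ (Fin 3)) := ⋃ i, leg i

/-- The ball `B_X(x,r)` has a `c`-antenna: there is a homeomorphism `h` of the tripod onto its
image, which lies in `B_X(x,r)`, such that `h(e_i)` has distance at least `c r` from
`h([0,e_j] ∪ [0,e_k])` whenever `i, j, k` are distinct. (Only the values of `h` on the tripod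
matter.) -/
def HasAntenna {X : Type*} [MetricSpace X] (c : ℝ) (x : X) (r : ℝ) : Prop :=
  ∃ h : EuclideanSpace ℝ (Fin 3) → X,
    IsEmbedding (tripod.domRestrict h) ∧ h '' tripod ⊆ ball x r ∧
      ∀ i j k : Fin 3, i ≠ j → j ≠ k → i ≠ k →
        c * r ≤ infDist (h (tip i)) (h '' (leg j ∪ leg k))

/-- `X` is `c`-antenna-like: every ball `B_X(x,r)` with `0 < r < diam X / 2` has a `c`-antenna. -/
def IsAntennaLike (X : Type*) [MetricSpace X] (c : ℝ) : Prop :=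
  ∀ (x : X) (r : ℝ), 0 < r → r < diam (univ : Set X) / 2 → HasAntenna c x r

/-- `f` is a quasisymmetric map: it is injective and there is an increasing homeomorphism
`η : (0,∞) → (0,∞)` with `|f(x) - f(y)| / |f(z) - f(y)| ≤ η(|x - y| / |z - y|)` for all
distinct `x, y, z`. -/
def IsQuasisymmetric {X Y : Type*} [MetricSpace X] [MetricSpace Y] (f : X → Y) : Prop :=
  Function.Injective f ∧
    ∃ η : Ioi (0 : ℝ) ≃ₜ Ioi (0 : ℝ), StrictMono η ∧
      ∀ (x y z : X) (hxy : x ≠ y) (hzy : z ≠ y), x ≠ z →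
        dist (f x) (f y) / dist (f z) (f y) ≤
          (η ⟨dist x y / dist z y, div_pos (dist_pos.2 hxy) (dist_pos.2 hzy)⟩ : ℝ)

end

/-! Deviation. Suppose an antenna lies within `ε` of a curve of length `L` whose ends have distance
`D`. Order its tips by the parameters of nearby curve points. The two outer legs form a connected
set, so some point of it is `ε`-close to the curve both before and after the middle parameter.
Between these two visits the curve makes a detour to the middle tip and back, so that tip lies
within `3 ε + (L - D) / 2` of the outer legs. Since this must be at least `c r`, while `D < 2 r`,
the quotient is at least `c / 6` (`exists_tip_near_opposite_legs`).

Dimension. The argument is intrinsic and does not use `betaPrime`. Cut a continuum of size `t` into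
`N` slabs between spheres about one of its points `p`. In each slab an antenna provides two distant
points on one sphere about `p`. Hence, besides the continua that cross the slab, there is room for
one more, and the total size of separated subcontinua grows by the factor `1 + c / 128`
(`IsAntennaLike.exists_sub_bridges`). Iterating this gain bounds `∑ rᵢ ^ s` below for all finite
ball covers, for some `s > 1` (`IsAntennaLike.le_sum_rpow_of_cover`), and compactness turns that
into a dimension bound.

Quasisymmetry. The map controls ratios of distances, so an antenna of a suitable ball in `X` is
carried to an antenna of the given ball in the image, with a constant depending only on `c` and the
gauge. The dimension bound then applies to the image. -/

/-! ### Subcontinua crossing between two levels -/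

/-- In a compact Hausdorff space a compact set missing the connected component of a point can be
separated from that point by a clopen set. -/
theorem exists_isClopen_disjoint_of_disjoint_connectedComponent {S : Type*} [TopologicalSpace S]
    [T2Space S] [CompactSpace S] {x : S} {B : Set S} (hB : IsClosed B)
    (hx : Disjoint (connectedComponent x) B) : ∃ U, IsClopen U ∧ x ∈ U ∧ Disjoint U B := by
  -- In a compact Hausdorff space the component is the intersection of the clopen sets around `x`;
  -- by compactness finitely many of them already miss `B`.
  obtain ⟨t, ht⟩ := hB.isCompact.elim_finite_subfamily_closed
    (fun U : { U : Set S // IsClopen U ∧ x ∈ U } => (U : Set S)) (fun U => U.2.1.isClosed) (by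
      rw [← connectedComponent_eq_iInter_isClopen]
      exact hx.symm.inter_eq)
  refine ⟨⋂ U ∈ t, (U : Set S), isClopen_biInter_finset fun U _ => U.2.1, ?_, ?_⟩
  · simp only [mem_iInter]
    exact fun U _ => U.2.2
  · exact (disjoint_iff_inter_eq_empty.2 ht).symm

/-- A continuum on which a continuous function passes from below `a` to above `b` contains a
continuum on which it takes exactly the values from `a` to `b`. -/
theorem IsPreconnected.exists_crossing {X : Type*} [TopologicalSpace X] [T2Space X] {K : Set X}
    (hc : IsPreconnected K) (hK : IsCompact K) {f : X → ℝ} (hf : Continuous f) {a b : ℝ}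
    (hab : a < b) {p q : X} (hp : p ∈ K) (hq : q ∈ K) (hpa : f p ≤ a) (hqb : b ≤ f q) :
    ∃ C ⊆ K, IsCompact C ∧ IsPreconnected C ∧ (∀ x ∈ C, a ≤ f x ∧ f x ≤ b) ∧
      (∃ u ∈ C, f u = a) ∧ ∃ v ∈ C, f v = b := by
  by_contra H
  set S : Set X := K ∩ f ⁻¹' Icc a b with hSdef
  have hS : IsCompact S := hK.inter_right (isClosed_Icc.preimage hf)
  have : CompactSpace S := isCompact_iff_compactSpace.1 hS
  have hfS : Continuous fun x : S => f x := hf.comp continuous_subtype_val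
  -- If no crossing continuum exists, the component in `S` of a point at level `a` misses level `b`.
  have key : ∀ x : S, f x = a → ∃ U : Set S, IsClopen U ∧ x ∈ U ∧ Disjoint U {y | f y = b} := by
    intro x hx
    refine exists_isClopen_disjoint_of_disjoint_connectedComponent
      (isClosed_eq hfS continuous_const) ?_
    rw [Set.disjoint_left]
    intro y hy hyb
    refine H ⟨Subtype.val '' connectedComponent x, ?_, ?_, ?_, ?_, ?_, ?_⟩
    · rintro _ ⟨z, -, rfl⟩
      exact z.2.1
    · exact (isClosed_connectedComponent.isCompact).image continuous_subtype_val
    · exact isPreconnected_connectedComponent.image _ continuous_subtype_val.continuousOn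
    · rintro _ ⟨z, -, rfl⟩
      exact z.2.2
    · exact ⟨x, ⟨x, mem_connectedComponent, rfl⟩, hx⟩
    · exact ⟨y, ⟨y, hy, rfl⟩, hyb⟩
  choose! U hU hxU hUB using key
  have hA : IsCompact {y : S | f y = a} := (isClosed_eq hfS continuous_const).isCompact
  obtain ⟨t, htA, ht⟩ := hA.elim_nhds_subcover U
    fun x hx => (hU x hx).isOpen.mem_nhds (hxU x hx)
  -- `V` is clopen in `S`, contains level `a` and misses level `b`, so it yields a separation of `K`
  -- into two disjoint closed parts.
  set V : Set S := ⋃ x ∈ t, U x with hV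
  have hVc : IsClopen V := isClopen_biUnion_finset fun x hx => hU x (htA x hx)
  have hVb : ∀ y ∈ V, f y ≠ b := by
    intro y hy hyb
    obtain ⟨x, hx, hyx⟩ := mem_iUnion₂.1 hy
    exact Set.disjoint_left.1 (hUB x (htA x hx)) hyx hyb
  have hc1 : IsClosed (Subtype.val '' V : Set X) :=
    (hVc.isClosed.isCompact.image continuous_subtype_val).isClosed
  have hc2 : IsClosed (Subtype.val '' Vᶜ : Set X) :=
    (hVc.compl.isClosed.isCompact.image continuous_subtype_val).isClosed
  obtain ⟨z, hzK, hz1, hz2⟩ := isPreconnected_closed_iff.1 hc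
    ({x | f x ≤ a} ∪ Subtype.val '' V) ({x | b ≤ f x} ∪ Subtype.val '' Vᶜ)
    ((isClosed_le hf continuous_const).union hc1) ((isClosed_le continuous_const hf).union hc2)
    (by
      intro x hx
      rcases le_or_gt (f x) a with h1 | h1
      · exact Or.inl (Or.inl h1)
      rcases le_or_gt b (f x) with h2 | h2
      · exact Or.inr (Or.inl h2)
      by_cases h3 : (⟨x, hx, h1.le, h2.le⟩ : S) ∈ V
      · exact Or.inl (Or.inr ⟨_, h3, rfl⟩)
      · exact Or.inr (Or.inr ⟨_, h3, rfl⟩))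
    ⟨p, hp, Or.inl hpa⟩ ⟨q, hq, Or.inl hqb⟩
  rcases hz1 with hz1 | ⟨y, hy, rfl⟩
  · rcases hz2 with hz2 | ⟨y', hy', rfl⟩
    · exact absurd (hz2.trans hz1) (not_le.2 hab)
    · exact hy' (ht (le_antisymm hz1 y'.2.2.1))
  · rcases hz2 with hz2 | ⟨y', hy', h⟩
    · exact hVb y hy (le_antisymm y.2.2.2 hz2)
    · exact hy' (by rwa [Subtype.ext h])

/-! ### Tripods and level sets -/

theorem isPreconnected_leg_union (i k : Fin 3) : IsPreconnected (leg i ∪ leg k) :=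
  IsPreconnected.union 0 (left_mem_segment _ _ _) (left_mem_segment _ _ _)
    (convex_segment _ _).isPreconnected (convex_segment _ _).isPreconnected

theorem leg_subset_tripod (i : Fin 3) : leg i ⊆ tripod := subset_iUnion leg i

theorem tip_mem_leg (i : Fin 3) : tip i ∈ leg i := right_mem_segment _ _ _

theorem continuousOn_of_isEmbedding_domRestrict {Z X : Type*} [TopologicalSpace Z]
    [TopologicalSpace X] {s : Set Z} {h : Z → X} (hh : IsEmbedding (s.domRestrict h)) :
    ContinuousOn h s :=
  continuousOn_iff_continuous_domRestrict.2 hh.continuous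

/-- Three reals can be put in increasing order. -/
theorem exists_monotone_triple (g : Fin 3 → ℝ) :
    ∃ i j k : Fin 3, i ≠ j ∧ j ≠ k ∧ i ≠ k ∧ g i ≤ g j ∧ g j ≤ g k := by
  rcases le_total (g 0) (g 1) with h1 | h1 <;> rcases le_total (g 1) (g 2) with h2 | h2 <;>
    rcases le_total (g 0) (g 2) with h3 | h3
  · exact ⟨0, 1, 2, by decide, by decide, by decide, h1, h2⟩
  · exact ⟨0, 1, 2, by decide, by decide, by decide, h1, h2⟩
  · exact ⟨0, 2, 1, by decide, by decide, by decide, h3, h2⟩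
  · exact ⟨2, 0, 1, by decide, by decide, by decide, h3, h1⟩
  · exact ⟨1, 0, 2, by decide, by decide, by decide, h1, h3⟩
  · exact ⟨1, 2, 0, by decide, by decide, by decide, h2, h3⟩
  · exact ⟨2, 1, 0, by decide, by decide, by decide, h2, h1⟩
  · exact ⟨2, 1, 0, by decide, by decide, by decide, h2, h1⟩

/-- An antenna meets some level set of any continuous function in two distant points. -/
theorem HasAntenna.exists_level_pair {X : Type*} [MetricSpace X] {c r : ℝ} {y : X}
    (H : HasAntenna c y r) {f : X → ℝ} (hf : Continuous f) :
    ∃ w ∈ ball y r, ∃ z ∈ ball y r, f w = f z ∧ c * r ≤ dist w z := by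
  obtain ⟨h, hemb, hball, hdist⟩ := H
  have hcont := continuousOn_of_isEmbedding_domRestrict hemb
  obtain ⟨i, j, k, hij, hjk, hik, h1, h2⟩ := exists_monotone_triple fun i => f (h (tip i))
  have hsub : leg i ∪ leg k ⊆ tripod := union_subset (leg_subset_tripod i) (leg_subset_tripod k)
  -- The middle tip value is also attained on the path joining the two other tips.
  obtain ⟨u, hu, hfu⟩ := (isPreconnected_leg_union i k).intermediate_value
    (Or.inl (tip_mem_leg i)) (Or.inr (tip_mem_leg k))
    (hf.comp_continuousOn (hcont.mono hsub)) ⟨h1, h2⟩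
  refine ⟨h (tip j), hball ⟨_, leg_subset_tripod j (tip_mem_leg j), rfl⟩, h u,
    hball ⟨u, hsub hu, rfl⟩, hfu.symm, ?_⟩
  exact (hdist j i k hij.symm hik hjk).trans (infDist_le_dist_of_mem ⟨u, hu, rfl⟩)

/-! ### Bridges in a slab between distance spheres -/

/-- `K` is a continuum containing two points at distance at least `t`. -/
def IsBridge {X : Type*} [MetricSpace X] (K : Set X) (t : ℝ) : Prop :=
  IsCompact K ∧ IsPreconnected K ∧ ∃ p ∈ K, ∃ q ∈ K, t ≤ dist p q

section Slab

variable {X : Type*} [MetricSpace X]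

/-- The distance to `p` is 1-Lipschitz, so a continuum running from level `a` to level `b` has size
at least `b - a`. -/
theorem IsPreconnected.exists_dist_crossing {K : Set X} (hc : IsPreconnected K)
    (hK : IsCompact K) {p q : X} (hp : p ∈ K) (hq : q ∈ K) {a b : ℝ} (ha : 0 ≤ a) (hab : a < b)
    (hb : b ≤ dist p q) :
    ∃ C ⊆ K, IsBridge C (b - a) ∧ ∀ x ∈ C, a ≤ dist p x ∧ dist p x ≤ b := by
  obtain ⟨C, hCK, hC, hCc, hCf, ⟨u, hu, hua⟩, v, hv, hvb⟩ := hc.exists_crossing hK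
    (f := fun x => dist p x) (by fun_prop) hab hp hq (by simpa using ha) hb
  refine ⟨C, hCK, ⟨hC, hCc, u, hu, v, hv, ?_⟩, hCf⟩
  have := dist_triangle p u v
  linarith

/-- Around a level containing two distant points there are two separated continua, the sizes of
which add up to more than the width of the slab crossed. -/
theorem exists_two_bridges [CompactSpace X] [ConnectedSpace X] {κ a : ℝ} (hκ : 0 < κ)
    {C : Set X} (hC : IsBridge C (2 * κ)) {p w z : X}
    (hCf : ∀ x ∈ C, a - κ ≤ dist p x ∧ dist p x ≤ a + κ) (hw : dist p w = a) (hz : dist p z = a)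
    (hwz : 8 * κ ≤ dist w z) :
    ∃ E F : Set X, IsBridge E (2 * κ) ∧ IsBridge F (κ / 2) ∧
      (∀ x ∈ E, x ∈ C) ∧
      (∀ x ∈ F, (x ∈ C ∨ dist x w ≤ κ / 2 ∨ dist x z ≤ κ / 2) ∧
        a - κ ≤ dist p x ∧ dist p x ≤ a + κ) ∧
      ∀ x ∈ E, ∀ y ∈ F, κ / 2 ≤ dist x y := by
  have aux : ∀ w z : X, dist p w = a → 8 * κ ≤ dist w z → (∀ x ∈ C, κ ≤ dist x w) →
      ∃ F : Set X, IsBridge F (κ / 2) ∧ (∀ x ∈ F, dist x w ≤ κ / 2 ∧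
        a - κ ≤ dist p x ∧ dist p x ≤ a + κ) ∧ ∀ x ∈ C, ∀ y ∈ F, κ / 2 ≤ dist x y := by
    intro w z hw hwz hCw
    obtain ⟨F, -, hF, hFw⟩ := isPreconnected_univ.exists_dist_crossing (X := X) isCompact_univ
      (mem_univ w) (mem_univ z) le_rfl (half_pos hκ) (by linarith)
    rw [sub_zero] at hF
    refine ⟨F, hF, fun x hx => ?_, fun x hx y hy => ?_⟩
    · have h1 := (hFw x hx).2
      have h2 := dist_triangle p w x
      have h3 := dist_triangle p x w
      rw [dist_comm x w] at *
      exact ⟨h1, by linarith, by linarith⟩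
    · have h1 := (hFw y hy).2
      have h2 := hCw x hx
      have h3 := dist_triangle x y w
      rw [dist_comm y w] at h3
      linarith
  -- If `C` avoids `w` or `z`, keep all of `C` and add a small continuum around the avoided point.
  by_cases h1 : ∀ x ∈ C, κ ≤ dist x w
  · obtain ⟨F, hF, hFx, hCF⟩ := aux w z hw hwz h1
    exact ⟨C, F, hC, hF, fun x hx => hx,
      fun x hx => ⟨Or.inr (Or.inl (hFx x hx).1), (hFx x hx).2⟩, hCF⟩
  by_cases h2 : ∀ x ∈ C, κ ≤ dist x z
  · obtain ⟨F, hF, hFx, hCF⟩ := aux z w hz (by rwa [dist_comm]) h2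
    exact ⟨C, F, hC, hF, fun x hx => hx,
      fun x hx => ⟨Or.inr (Or.inr (hFx x hx).1), (hFx x hx).2⟩, hCF⟩
  -- Otherwise `C` comes near both points and is at least `6 κ` long. The shells `[0, 2κ]` and `[3κ,
  -- 3κ + κ/2]` about `u` then cut out two separated pieces of it.
  push Not at h1 h2
  obtain ⟨u, hu, huw⟩ := h1
  obtain ⟨v, hv, hvz⟩ := h2
  have huv : 6 * κ ≤ dist u v := by
    have h1 := dist_triangle4 w u v z
    rw [dist_comm w u] at h1
    linarith
  obtain ⟨E, hEC, hE, hEu⟩ := hC.2.1.exists_dist_crossing hC.1 hu hv le_rfl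
    (show 0 < 2 * κ by linarith) (by linarith)
  obtain ⟨F, hFC, hF, hFu⟩ := hC.2.1.exists_dist_crossing hC.1 hu hv
    (show 0 ≤ 3 * κ by linarith) (show 3 * κ < 3 * κ + κ / 2 by linarith) (by linarith)
  rw [sub_zero] at hE
  rw [add_sub_cancel_left] at hF
  refine ⟨E, F, hE, hF, fun x hx => hEC hx, fun x hx => ⟨Or.inl (hFC hx), hCf x (hFC hx)⟩, ?_⟩
  intro x hx y hy
  have h1 := (hEu x hx).2
  have h2 := (hFu y hy).1
  have h3 := dist_triangle u x y
  linarith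

/-- In an antenna-like continuum, a slab of width `η` between distance spheres that is crossed by
a continuum `K` contains four separated continua near `K` of total size larger than `η`. -/
theorem IsAntennaLike.exists_four_bridges [CompactSpace X] [ConnectedSpace X] {c : ℝ}
    (hX : IsAntennaLike X c) (hc : 0 < c) (hc2 : c ≤ 2) {K : Set X} (hK : IsCompact K)
    (hKc : IsPreconnected K) {p q : X} (hp : p ∈ K) (hq : q ∈ K) {l η : ℝ} (hl : 0 ≤ l)
    (hη : 0 < η) (hlq : l + η ≤ dist p q) :
    ∃ (E : Fin 4 → Set X) (s : Fin 4 → ℝ),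
      (∀ i, IsBridge (E i) (s i) ∧ c * η / 64 ≤ s i ∧ s i ≤ η) ∧
      (∀ i, ∀ x ∈ E i, l + c * η / 512 ≤ dist p x ∧ dist p x ≤ l + η - c * η / 512 ∧
        ∃ y ∈ K, dist x y ≤ η) ∧
      (∀ i j, i ≠ j → ∀ x ∈ E i, ∀ y ∈ E j, c * η / 512 ≤ dist x y) ∧
      (1 + c / 128) * η ≤ ∑ i, s i := by
  have hcη : 0 < c * η := mul_pos hc hη
  have hcη2 : c * η ≤ 2 * η := by nlinarith
  -- A point of `K` at mid-slab: the ball of radius `η / 4` around it stays in the middle half of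
  -- the slab.
  obtain ⟨y, hy, hyl⟩ := hKc.intermediate_value hp hq
    (f := fun x => dist p x) (by fun_prop) (show l + η / 2 ∈ _ from
      ⟨by simpa using by positivity, by linarith⟩)
  have hdiam : η ≤ diam (univ : Set X) := by
    have := dist_le_diam_of_mem isCompact_univ.isBounded (mem_univ p) (mem_univ q)
    linarith
  obtain ⟨w, hw, z, hz, hwz, hd⟩ := (hX y (η / 4) (by positivity) (by linarith)).exists_level_pair
    (f := fun x => dist p x) (by fun_prop)
  simp only at hyl hwz
  set a := dist p w with ha
  rw [mem_ball] at hw hz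
  have ha1 : l + η / 4 < a := by
    have := dist_triangle p w y
    linarith
  have ha2 : a < l + 3 * η / 4 := by
    have := dist_triangle p y w
    rw [dist_comm y w] at this
    linarith
  have hcr {a' b' : ℝ} := hKc.exists_dist_crossing (a := a') (b := b') hK hp hq
  -- `C₁`, `C`, `C₂` cross below, around and above level `a`, with margins `c * η / 512` for
  -- separation.
  obtain ⟨C₁, hC₁K, hC₁, hC₁f⟩ := hcr (show 0 ≤ l + c * η / 512 by positivity)
    (show l + c * η / 512 < a - c * η / 32 - c * η / 512 by linarith) (by linarith)
  obtain ⟨C, hCK, hC, hCf⟩ := hcr (show 0 ≤ a - c * η / 32 by linarith)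
    (show a - c * η / 32 < a + c * η / 32 by linarith) (by linarith)
  obtain ⟨C₂, hC₂K, hC₂, hC₂f⟩ := hcr (show 0 ≤ a + c * η / 32 + c * η / 512 by linarith)
    (show a + c * η / 32 + c * η / 512 < l + η - c * η / 512 by linarith) (by linarith)
  -- The antenna separation `c * (η / 4)` is exactly `8 κ`.
  obtain ⟨E, F, hE, hF, hEC, hFx, hEF⟩ := exists_two_bridges (κ := c * η / 32) (a := a)
    (by positivity) (by convert hC using 1; ring) hCf rfl hwz.symm (by linarith)
  have hEf : ∀ x ∈ E, a - c * η / 32 ≤ dist p x ∧ dist p x ≤ a + c * η / 32 :=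
    fun x hx => hCf x (hEC x hx)
  have hsep : ∀ {u v : X}, dist p u + c * η / 512 ≤ dist p v → c * η / 512 ≤ dist u v := by
    intro u v h
    have := dist_triangle p u v
    linarith
  have hself : ∀ x ∈ K, ∃ y ∈ K, dist x y ≤ η := fun x hx => ⟨x, hx, by simpa using hη.le⟩
  have hlt : ∀ i j : Fin 4, i < j → ∀ x ∈ (![C₁, E, F, C₂] : Fin 4 → Set X) i,
      ∀ y ∈ (![C₁, E, F, C₂] : Fin 4 → Set X) j, c * η / 512 ≤ dist x y := by
    intro i j hij x hx y hy
    fin_cases i <;> fin_cases j <;> first | exact absurd hij (by decide) | skip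
    · exact hsep (by linarith [hC₁f x hx, hEf y hy])
    · exact hsep (by linarith [hC₁f x hx, (hFx y hy).2])
    · exact hsep (by linarith [hC₁f x hx, hC₂f y hy])
    · linarith [hEF x hx y hy]
    · exact hsep (by linarith [hEf x hx, hC₂f y hy])
    · exact hsep (by linarith [(hFx x hx).2, hC₂f y hy])
  -- The four margins lose `c * η / 128` in all; `F` adds `c * η / 64`, so the net gain is `c * η /
  -- 128`.
  refine ⟨![C₁, E, F, C₂], ![a - c * η / 32 - c * η / 512 - (l + c * η / 512),
    2 * (c * η / 32), c * η / 32 / 2, l + η - c * η / 512 - (a + c * η / 32 + c * η / 512)],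
    ?_, ?_, ?_, ?_⟩
  · intro i
    fin_cases i
    · exact ⟨hC₁, by dsimp; linarith, by dsimp; linarith⟩
    · exact ⟨hE, by dsimp; linarith, by dsimp; linarith⟩
    · exact ⟨hF, by dsimp; linarith, by dsimp; linarith⟩
    · exact ⟨hC₂, by dsimp; linarith, by dsimp; linarith⟩
  · intro i x hx
    fin_cases i <;> simp only [Fin.mk_one, Fin.zero_eta, Fin.reduceFinMk, Matrix.cons_val] at hx
    · have := hC₁f x hx
      exact ⟨by linarith, by linarith, hself x (hC₁K hx)⟩
    · have := hEf x hx
      exact ⟨by linarith, by linarith, hself x (hCK (hEC x hx))⟩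
    · have := (hFx x hx).2
      refine ⟨by linarith, by linarith, ?_⟩
      rcases (hFx x hx).1 with h | h | h
      · exact hself x (hCK h)
      · exact ⟨y, hy, by linarith [dist_triangle x w y]⟩
      · exact ⟨y, hy, by linarith [dist_triangle x z y]⟩
    · have := hC₂f x hx
      exact ⟨by linarith, by linarith, hself x (hC₂K hx)⟩
  · intro i j hij x hx y hy
    rcases lt_or_gt_of_ne hij with h | h
    · exact hlt i j h x hx y hy
    · rw [dist_comm]
      exact hlt j i h y hy x hx
  · simp only [Fin.sum_univ_four, Matrix.cons_val]
    linarith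

end Slab

/-! ### Lower bound for the dimension -/

section Dimension

variable {X : Type*} [MetricSpace X]

/-- In an antenna-like continuum, every bridge of size `t` has in its `t / N`-neighbourhood a
separated family of bridges of comparable sizes that sum up to `(1 + c / 128) t`. -/
theorem IsAntennaLike.exists_sub_bridges [CompactSpace X] [ConnectedSpace X] {c : ℝ}
    (hX : IsAntennaLike X c) (hc : 0 < c) (hc2 : c ≤ 2) {K : Set X} {t : ℝ} (ht : 0 < t)
    (hK : IsBridge K t) {N : ℕ} (hN : 0 < N) :
    ∃ (E : Fin N × Fin 4 → Set X) (s : Fin N × Fin 4 → ℝ),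
      (∀ i, IsBridge (E i) (s i) ∧ c * (t / N) / 64 ≤ s i ∧ s i ≤ t / N) ∧
      (∀ i, ∀ x ∈ E i, ∃ y ∈ K, dist x y ≤ t / N) ∧
      (∀ i j, i ≠ j → ∀ x ∈ E i, ∀ y ∈ E j, c * (t / N) / 512 ≤ dist x y) ∧
      (1 + c / 128) * t ≤ ∑ i, s i := by
  obtain ⟨hKc, hKp, p, hp, q, hq, hpq⟩ := hK
  have hN' : (0 : ℝ) < N := by exact_mod_cast hN
  set η := t / N with hη
  have hη0 : 0 < η := div_pos ht hN'
  have hNη : N * η = t := by rw [hη]; field_simp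
  have key : ∀ j : Fin N, _ := fun j =>
    hX.exists_four_bridges hc hc2 hKc hKp hp hq (l := j * η) (by positivity) hη0 (by
      have h1 : ((j : ℕ) : ℝ) + 1 ≤ N := by exact_mod_cast j.2
      nlinarith)
  choose E s h1 h2 h3 h4 using key
  have hcη : 0 < c * η := mul_pos hc hη0
  have hlt : ∀ i j : Fin N × Fin 4, i.1 < j.1 → ∀ x ∈ E i.1 i.2, ∀ y ∈ E j.1 j.2,
      c * η / 512 ≤ dist x y := by
    intro i j hij x hx y hy
    have ha := (h2 _ _ x hx).2.1
    have hb := (h2 _ _ y hy).1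
    have hd := dist_triangle p x y
    have hij' : ((i.1 : ℕ) : ℝ) + 1 ≤ (j.1 : ℕ) := by exact_mod_cast hij
    nlinarith
  refine ⟨fun i => E i.1 i.2, fun i => s i.1 i.2, fun i => h1 _ _,
    fun i x hx => (h2 _ _ x hx).2.2, fun i j hij x hx y hy => ?_, ?_⟩
  · rcases lt_trichotomy i.1 j.1 with h | h | h
    · exact hlt i j h x hx y hy
    · obtain ⟨i₁, i₂⟩ := i
      obtain ⟨j₁, j₂⟩ := j
      obtain rfl : i₁ = j₁ := h
      exact h3 _ _ _ (fun h => hij (congrArg (Prod.mk i₁) h)) x hx y hy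
    · rw [dist_comm]
      exact hlt j i h y hy x hx
  · rw [Fintype.sum_prod_type]
    calc (1 + c / 128) * t = ∑ _j : Fin N, (1 + c / 128) * η := by
          rw [Finset.sum_const, Finset.card_univ, Fintype.card_fin, nsmul_eq_mul, ← hNη]
          ring
      _ ≤ _ := Finset.sum_le_sum fun j _ => h4 j

/-- Lower bound for the content of a neighbourhood of a bridge in an antenna-like continuum. -/
theorem IsAntennaLike.le_sum_rpow_of_cover [CompactSpace X] [ConnectedSpace X] {c : ℝ}
    (hX : IsAntennaLike X c) (hc : 0 < c) (hc2 : c ≤ 2) {N : ℕ} (hN : 4096 / c ≤ N) {s : ℝ}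
    (hs1 : 1 ≤ s) (hs : 1 ≤ (1 + c / 128) * (c / (64 * N)) ^ (s - 1)) {ρ : ℝ} (hρ : 0 < ρ)
    {ι : Type*} (z : ι → X) (r : ι → ℝ) (n : ℕ) :
    ∀ (I : Finset ι) (K : Set X) (t : ℝ), (∀ i ∈ I, ρ ≤ r i) → 0 < t → t ≤ ρ * 2 ^ n →
      IsBridge K t →
      (∀ x, ∀ y ∈ K, dist x y ≤ c / 2048 * t → ∃ i ∈ I, x ∈ ball (z i) (r i)) →
      (c / 2048 * (t / N)) ^ s ≤ ∑ i ∈ I, r i ^ s := by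
  have hN2 : (2048 : ℝ) ≤ N := le_trans (by rw [le_div_iff₀ hc]; linarith) hN
  have hN0 : (0 : ℝ) < N := by linarith
  have hN0' : 0 < N := by exact_mod_cast hN0
  have hs0 : 0 ≤ s := by linarith
  -- A single ball of radius at least `c / 2048 * (t / N)` already gives the bound, so below all
  -- balls may be taken smaller than that.
  have big : ∀ (I : Finset ι) (t : ℝ), (∀ i ∈ I, ρ ≤ r i) → 0 < t →
      (∃ i ∈ I, c / 2048 * (t / N) ≤ r i) → (c / 2048 * (t / N)) ^ s ≤ ∑ i ∈ I, r i ^ s := by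
    rintro I t hI ht ⟨i, hi, hri⟩
    calc (c / 2048 * (t / N)) ^ s ≤ r i ^ s := Real.rpow_le_rpow (by positivity) hri hs0
      _ ≤ _ := Finset.single_le_sum (f := fun i => r i ^ s)
        (fun i hi => Real.rpow_nonneg (hρ.le.trans (hI i hi)) s) hi
  induction n with
  | zero =>
    intro I K t hI ht htρ hK hcov
    obtain ⟨-, -, p, hp, -⟩ := hK
    obtain ⟨i, hi, -⟩ := hcov p p hp (by rw [dist_self]; positivity)
    refine big I t hI ht ⟨i, hi, le_trans ?_ (hI i hi)⟩
    have h1 : t / N ≤ t := div_le_self ht.le (by linarith)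
    have h2 : 0 ≤ t / N := by positivity
    rw [pow_zero, mul_one] at htρ
    nlinarith
  | succ n ih =>
    intro I K t hI ht htρ hK hcov
    by_cases hbig : ∃ i ∈ I, c / 2048 * (t / N) ≤ r i
    · exact big I t hI ht hbig
    push Not at hbig
    obtain ⟨E, τ, hE, hEK, hsep, hsum⟩ := hX.exists_sub_bridges hc hc2 ht hK hN0'
    set η := t / N with hη
    have hη0 : 0 < η := div_pos ht hN0
    have hcη : 0 < c * η := mul_pos hc hη0
    have hτ0 : ∀ i, 0 < τ i := fun i => lt_of_lt_of_le (by positivity) (hE i).2.1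
    have hηt : 4096 * η ≤ c * t := by
      rw [div_le_iff₀ hc] at hN
      have : N * η = t := by rw [hη]; field_simp
      nlinarith
    classical
    -- The balls meeting the neighbourhood of the `j`-th child bridge.
    let J : Fin N × Fin 4 → Finset ι := fun j =>
      I.filter fun i => ∃ x ∈ ball (z i) (r i), ∃ y ∈ E j, dist x y ≤ c / 2048 * τ j
    have hJ : ∀ j, J j ⊆ I := fun j => Finset.filter_subset _ _
    have hterr : ∀ j, c / 2048 * τ j ≤ c * η / 2048 := by
      intro j
      have := (hE j).2.2
      nlinarith
    -- Two neighbourhood radii plus one ball diameter stay below `4 * (c * η / 2048)`, the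
    -- separation of the children.
    have hdisj : Set.PairwiseDisjoint (↑(Finset.univ : Finset (Fin N × Fin 4))) J := by
      intro j _ k _ hjk
      rw [Function.onFun, Finset.disjoint_left]
      intro i hij hik
      obtain ⟨hi, x, hx, y, hy, hxy⟩ := Finset.mem_filter.1 hij
      obtain ⟨-, x', hx', y', hy', hxy'⟩ := Finset.mem_filter.1 hik
      have h1 := hsep j k hjk y hy y' hy'
      have h2 := hbig i hi
      have h3 := hterr j
      have h4 := hterr k
      rw [mem_ball] at hx hx'
      have h5 := dist_triangle4 y x x' y'
      have h6 := dist_triangle_right x x' (z i)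
      rw [dist_comm y x] at h5
      linarith
    have hchild : ∀ j, (c / 2048 * (τ j / N)) ^ s ≤ ∑ i ∈ J j, r i ^ s := by
      intro j
      refine ih (J j) (E j) (τ j) (fun i hi => hI i (hJ j hi)) (hτ0 j) ?_ (hE j).1 ?_
      · have h1 := (hE j).2.2
        rw [pow_succ] at htρ
        nlinarith
      -- `N ≥ 4096 / c` gives `2 η ≤ c * t / 2048`, so the child's neighbourhood lies in the
      -- parent's, where the cover is available.
      · intro x y hy hxy
        obtain ⟨y', hy', hyy'⟩ := hEK j y hy
        obtain ⟨i, hi, hxi⟩ := hcov x y' hy' (by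
          have h1 := dist_triangle x y y'
          have h2 := hterr j
          nlinarith)
        exact ⟨i, Finset.mem_filter.2 ⟨hi, x, hxi, y, hy, hxy⟩, hxi⟩
    -- As `τ j ≥ c / (64 N) * t`, passing from exponent `1` to `s` costs at most the factor `(c /
    -- (64 N)) ^ (s - 1)`, which `hs` lets the length gain absorb.
    have hτs : t ^ s ≤ ∑ j, τ j ^ s := by
      have hβ : ∀ j, (c / (64 * N) * t) ^ (s - 1) * τ j ≤ τ j ^ s := by
        intro j
        have h1 : τ j ^ s = τ j ^ (s - 1) * τ j := by
          rw [← Real.rpow_add_one (hτ0 j).ne']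
          congr 1
          ring
        rw [h1]
        refine mul_le_mul_of_nonneg_right
          (Real.rpow_le_rpow (by positivity) ?_ (by linarith)) (hτ0 j).le
        refine le_trans (le_of_eq ?_) (hE j).2.1
        rw [hη]
        field_simp
      have ht1 : t ^ s = t ^ (s - 1) * t := by
        rw [← Real.rpow_add_one ht.ne']
        congr 1
        ring
      calc t ^ s ≤ ((1 + c / 128) * (c / (64 * N)) ^ (s - 1)) * t ^ s :=
            le_mul_of_one_le_left (Real.rpow_nonneg ht.le s) hs
        _ = (c / (64 * N) * t) ^ (s - 1) * ((1 + c / 128) * t) := by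
            rw [Real.mul_rpow (by positivity) ht.le, ht1]
            ring
        _ ≤ (c / (64 * N) * t) ^ (s - 1) * ∑ j, τ j :=
            mul_le_mul_of_nonneg_left hsum (by positivity)
        _ ≤ ∑ j, τ j ^ s := by
            rw [Finset.mul_sum]
            exact Finset.sum_le_sum fun j _ => hβ j
    calc (c / 2048 * η) ^ s = (c / 2048 / N) ^ s * t ^ s := by
          rw [← Real.mul_rpow (by positivity) ht.le, hη]
          congr 1
          ring
      _ ≤ (c / 2048 / N) ^ s * ∑ j, τ j ^ s :=
          mul_le_mul_of_nonneg_left hτs (by positivity)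
      _ = ∑ j, (c / 2048 * (τ j / N)) ^ s := by
          rw [Finset.mul_sum]
          refine Finset.sum_congr rfl fun j _ => ?_
          rw [← Real.mul_rpow (by positivity) (hτ0 j).le]
          congr 1
          ring
      _ ≤ ∑ j, ∑ i ∈ J j, r i ^ s := Finset.sum_le_sum fun j _ => hchild j
      _ = ∑ i ∈ Finset.univ.biUnion J, r i ^ s := (Finset.sum_biUnion hdisj).symm
      _ ≤ ∑ i ∈ I, r i ^ s := Finset.sum_le_sum_of_subset_of_nonneg
          (Finset.biUnion_subset.2 fun j _ => hJ j)
          fun i hi _ => Real.rpow_nonneg (hρ.le.trans (hI i hi)) s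

/-- A compact space all of whose finite covers by balls satisfy `κ ≤ ∑ rᵢ ^ s` has dimension at
least `s`. -/
theorem le_dimH_of_le_sum_rpow [CompactSpace X] [Nonempty X] {s κ : ℝ} (hs : 0 < s) (hκ : 0 < κ)
    (H : ∀ (z : ℕ → X) (r : ℕ → ℝ) (I : Finset ℕ), (∀ i, 0 < r i) →
      (∀ x, ∃ i ∈ I, x ∈ ball (z i) (r i)) → κ ≤ ∑ i ∈ I, r i ^ s) :
    ENNReal.ofReal s ≤ dimH (univ : Set X) := by
  borelize X
  refine le_dimH_of_hausdorffMeasure_ne_zero (d := s.toNNReal) fun h0 => ?_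
  rw [Real.coe_toNNReal s hs.le, MeasureTheory.Measure.hausdorffMeasure_apply,
    ENNReal.iSup_eq_zero] at h0
  have h1 := h0 1
  rw [ENNReal.iSup_eq_zero] at h1
  have hε : (0 : ℝ≥0∞) < ENNReal.ofReal (κ / 4) := by
    rw [ENNReal.ofReal_pos]
    positivity
  obtain ⟨t, htcov, -, htsum⟩ : ∃ t : ℕ → Set X, ∃ _ : univ ⊆ ⋃ n, t n,
      ∃ _ : ∀ n, ediam (t n) ≤ 1,
        ∑' n, ⨆ _ : (t n).Nonempty, ediam (t n) ^ s < ENNReal.ofReal (κ / 4) := by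
    have h2 := (h1 one_pos).trans_lt hε
    simpa only [iInf_lt_iff] using h2
  -- Enlarging the sets to open balls costs another `κ / 4` in total, so a finite subcover has sum
  -- at most `κ / 2`.
  obtain ⟨δ, hδ0, hδ⟩ := ENNReal.exists_pos_sum_of_countable' hε.ne' ℕ
  have key : ∀ n, ∃ (z : X) (r : ℝ), 0 < r ∧ t n ⊆ ball z r ∧
      ENNReal.ofReal (r ^ s) ≤ (⨆ _ : (t n).Nonempty, ediam (t n) ^ s) + δ n := by
    intro n
    have hbdd : Bornology.IsBounded (t n) := isCompact_univ.isBounded.subset (subset_univ _)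
    have hle : ENNReal.ofReal (diam (t n) ^ s) ≤ ⨆ _ : (t n).Nonempty, ediam (t n) ^ s := by
      rcases (t n).eq_empty_or_nonempty with hne | hne
      · simp [hne, Real.zero_rpow hs.ne']
      · refine le_trans (le_of_eq ?_) (le_iSup (fun _ : (t n).Nonempty => ediam (t n) ^ s) hne)
        rw [← ENNReal.ofReal_rpow_of_nonneg diam_nonneg hs.le, diam,
          ENNReal.ofReal_toReal hbdd.ediam_ne_top]
    have hlt : ENNReal.ofReal (diam (t n) ^ s) < ENNReal.ofReal (diam (t n) ^ s) + δ n :=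
      ENNReal.lt_add_right ENNReal.ofReal_ne_top (hδ0 n).ne'
    have hcont : Continuous fun u : ℝ => ENNReal.ofReal (u ^ s) :=
      ENNReal.continuous_ofReal.comp (Real.continuous_rpow_const hs.le)
    have hev : ∀ᶠ u in 𝓝[>] diam (t n),
        ENNReal.ofReal (u ^ s) < ENNReal.ofReal (diam (t n) ^ s) + δ n :=
      ((hcont.tendsto _).eventually (gt_mem_nhds hlt)).filter_mono nhdsWithin_le_nhds
    obtain ⟨u, hu, hu'⟩ := (hev.and self_mem_nhdsWithin).exists
    have hu' : diam (t n) < u := hu'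
    obtain ⟨z, hz⟩ : ∃ z, (t n).Nonempty → z ∈ t n := by
      by_cases h : (t n).Nonempty
      · exact ⟨h.choose, fun _ => h.choose_spec⟩
      · exact ⟨Classical.arbitrary X, fun h' => absurd h' h⟩
    exact ⟨z, u, diam_nonneg.trans_lt hu', fun x hx =>
      (dist_le_diam_of_mem hbdd hx (hz ⟨x, hx⟩)).trans_lt hu', hu.le.trans (by gcongr)⟩
  choose z r hr hball hsum using key
  obtain ⟨I, hI⟩ := isCompact_univ.elim_finite_subcover (fun n => ball (z n) (r n))
    (fun n => isOpen_ball) (htcov.trans (iUnion_mono hball))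
  have hκI := H z r I hr fun x => by simpa using hI (mem_univ x)
  have hfin : ENNReal.ofReal κ ≤ ENNReal.ofReal (κ / 4) + ENNReal.ofReal (κ / 4) := calc
    ENNReal.ofReal κ ≤ ENNReal.ofReal (∑ i ∈ I, r i ^ s) := ENNReal.ofReal_le_ofReal hκI
    _ = ∑ i ∈ I, ENNReal.ofReal (r i ^ s) :=
      ENNReal.ofReal_sum_of_nonneg fun i _ => Real.rpow_nonneg (hr i).le s
    _ ≤ ∑' i, ENNReal.ofReal (r i ^ s) := ENNReal.sum_le_tsum I
    _ ≤ ∑' i, ((⨆ _ : (t i).Nonempty, ediam (t i) ^ s) + δ i) := ENNReal.tsum_le_tsum hsum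
    _ = _ := ENNReal.tsum_add
    _ ≤ _ := add_le_add htsum.le hδ.le
  rw [← ENNReal.ofReal_add (by positivity) (by positivity),
    ENNReal.ofReal_le_ofReal_iff (by positivity)] at hfin
  linarith

/-- The constant of an antenna-like space is at most two. -/
theorem IsAntennaLike.le_two [CompactSpace X] [Nontrivial X] {c : ℝ}
    (hX : IsAntennaLike X c) : c ≤ 2 := by
  obtain ⟨x, y, hxy⟩ := exists_pair_ne X
  have hd : 0 < diam (univ : Set X) := (dist_pos.2 hxy).trans_le
    (dist_le_diam_of_mem isCompact_univ.isBounded (mem_univ x) (mem_univ y))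
  have hr : 0 < diam (univ : Set X) / 4 := by positivity
  obtain ⟨w, hw, z, hz, -, hwz⟩ := (hX x _ hr (by linarith)).exists_level_pair
    (f := fun _ => 0) continuous_const
  have h1 := dist_triangle_right w z x
  rw [mem_ball] at hw hz
  by_contra! h
  nlinarith

/-- An antenna-like continuum with constant `c` has dimension at least `1 + c ^ 2 / 2 ^ 20`. -/
theorem IsAntennaLike.le_dimH [CompactSpace X] [ConnectedSpace X] [Nontrivial X] {c : ℝ}
    (hX : IsAntennaLike X c) (hc : 0 < c) :
    ENNReal.ofReal (1 + c ^ 2 / 2 ^ 20) ≤ dimH (univ : Set X) := by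
  have hc2 := hX.le_two
  set N := ⌈4096 / c⌉₊ with hN
  have hN1 : 4096 / c ≤ N := Nat.le_ceil _
  have hN2 : (N : ℝ) ≤ 8192 / c := by
    have h1 := Nat.ceil_lt_add_one (show 0 ≤ 4096 / c by positivity)
    have h2 : 1 ≤ 4096 / c := by rw [le_div_iff₀ hc]; linarith
    have h3 : 8192 / c = 4096 / c + 4096 / c := by ring
    linarith
  have hN0 : (0 : ℝ) < N := lt_of_lt_of_le (by positivity) hN1
  have hs : 1 ≤ (1 + c / 128) * (c / (64 * N)) ^ (1 + c ^ 2 / 2 ^ 20 - 1) := by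
    have h1 : (c / 1024) ^ 2 ≤ c / (64 * N) := by
      rw [le_div_iff₀ hc] at hN2
      rw [le_div_iff₀ (by positivity)]
      nlinarith
    -- This crude bound for the logarithm is what makes the dimension gain quadratic in `c`.
    have h2 : -(1024 / c) ≤ Real.log (c / 1024) := by
      have h := Real.log_le_sub_one_of_pos (show 0 < 1024 / c by positivity)
      have h' : Real.log (c / 1024) = -Real.log (1024 / c) := by
        rw [← Real.log_inv, inv_div]
      linarith
    have h3 : 1 - c / 512 ≤ ((c / 1024) ^ 2) ^ (1 + c ^ 2 / 2 ^ 20 - 1) := by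
      rw [Real.rpow_def_of_pos (by positivity), Real.log_pow]
      refine le_trans ?_ (Real.add_one_le_exp _)
      have : c ^ 2 / 2 ^ 20 * (2 * -(1024 / c)) = - c / 512 := by
        field_simp
        norm_num
      have h4 : c ^ 2 / 2 ^ 20 * (2 * -(1024 / c)) ≤ c ^ 2 / 2 ^ 20 * (2 * Real.log (c / 1024)) := by
        gcongr
      rw [add_sub_cancel_left]
      push_cast
      linarith
    calc (1 : ℝ) ≤ (1 + c / 128) * (1 - c / 512) := by nlinarith
      _ ≤ (1 + c / 128) * ((c / 1024) ^ 2) ^ (1 + c ^ 2 / 2 ^ 20 - 1) := by gcongr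
      _ ≤ _ := by
        gcongr
        rw [add_sub_cancel_left]
        positivity
  obtain ⟨x, y, hxy⟩ := exists_pair_ne X
  have hd : 0 < dist x y := dist_pos.2 hxy
  refine le_dimH_of_le_sum_rpow (κ := (c / 2048 * (dist x y / N)) ^ (1 + c ^ 2 / 2 ^ 20))
    (by positivity) (by positivity) fun z r I hr hI => ?_
  have hIne : I.Nonempty := by
    obtain ⟨i, hi, -⟩ := hI x
    exact ⟨i, hi⟩
  -- The smallest radius serves as `ρ`; it determines the depth `n` of the recursion.
  obtain ⟨i₀, -, hi₀⟩ := I.exists_min_image r hIne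
  obtain ⟨n, hn⟩ := pow_unbounded_of_one_lt (dist x y / r i₀) one_lt_two
  rw [div_lt_iff₀ (hr i₀), mul_comm] at hn
  exact hX.le_sum_rpow_of_cover hc hc2 hN1 (by linarith [show 0 ≤ c ^ 2 / 2 ^ 20 by positivity]) hs
    (hr i₀) z r n I univ (dist x y) hi₀ hd hn.le
    ⟨isCompact_univ, isPreconnected_univ, x, mem_univ x, y, mem_univ y, le_rfl⟩
    fun x _ _ _ => hI x

end Dimension

/-! ### Antennas and the geodesic deviation -/

/-- The length of a curve bounds the length of each inscribed polygon with three inner vertices. -/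
theorem edist_add_edist_le_eVariationOn {E : Type*} [PseudoEMetricSpace E] (s : unitInterval → E)
    {a t b : unitInterval} (hat : a ≤ t) (htb : t ≤ b) :
    edist (s 0) (s a) + edist (s a) (s t) + edist (s t) (s b) + edist (s b) (s 1) ≤
      eVariationOn s univ := by
  have h : ∀ {x y : unitInterval}, x ≤ y → edist (s x) (s y) ≤ eVariationOn s (univ ∩ Icc x y) :=
    fun hxy => eVariationOn.edist_le s ⟨mem_univ _, left_mem_Icc.2 hxy⟩
      ⟨mem_univ _, right_mem_Icc.2 hxy⟩
  have h0 : (0 : unitInterval) ≤ a := unitInterval.nonneg'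
  have h1 : b ≤ (1 : unitInterval) := unitInterval.le_one'
  calc _ ≤ eVariationOn s (univ ∩ Icc 0 a) + eVariationOn s (univ ∩ Icc a t) +
        eVariationOn s (univ ∩ Icc t b) + eVariationOn s (univ ∩ Icc b 1) := by
        gcongr <;> exact h ‹_›
    _ = eVariationOn s (univ ∩ Icc 0 1) := by
        rw [eVariationOn.Icc_add_Icc s h0 hat (mem_univ _),
          eVariationOn.Icc_add_Icc s (h0.trans hat) htb (mem_univ _),
          eVariationOn.Icc_add_Icc s ((h0.trans hat).trans htb) h1 (mem_univ _)]
    _ ≤ _ := eVariationOn.mono s inter_subset_left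

/-- A tripod lying within `ε` of a curve has a tip that is close to the union of the opposite two
legs, in terms of `ε` and of the amount by which the length of the curve exceeds the distance of
its end points. -/
theorem exists_tip_near_opposite_legs {E : Type*} [MetricSpace E] (s : C(unitInterval, E))
    {h : EuclideanSpace ℝ (Fin 3) → E} (hh : ContinuousOn h tripod) {L ε : ℝ}
    (hL : ∀ a t b : unitInterval, a ≤ t → t ≤ b →
      dist (s 0) (s a) + dist (s a) (s t) + dist (s t) (s b) + dist (s b) (s 1) ≤ L)
    (hε : ∀ x ∈ tripod, ∃ t, dist (h x) (s t) ≤ ε) :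
    ∃ i j k : Fin 3, i ≠ j ∧ j ≠ k ∧ i ≠ k ∧
      infDist (h (tip j)) (h '' (leg i ∪ leg k)) ≤ 3 * ε + (L - dist (s 0) (s 1)) / 2 := by
  have htip : ∀ i, ∃ t, dist (h (tip i)) (s t) ≤ ε :=
    fun i => hε _ (leg_subset_tripod i (tip_mem_leg i))
  choose τ hτ using htip
  obtain ⟨i, j, k, hij, hjk, hik, h1, h2⟩ := exists_monotone_triple fun i => (τ i : ℝ)
  have h1 : τ i ≤ τ j := h1
  have h2 : τ j ≤ τ k := h2
  refine ⟨i, j, k, hij, hjk, hik, ?_⟩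
  have hsub : leg i ∪ leg k ⊆ tripod := union_subset (leg_subset_tripod i) (leg_subset_tripod k)
  have hconn : IsPreconnected (h '' (leg i ∪ leg k)) :=
    (isPreconnected_leg_union i k).image h (hh.mono hsub)
  have hle : ∀ {x : E} {I : Set unitInterval} {t : unitInterval}, t ∈ I → dist x (s t) ≤ ε →
      infDist x (s '' I) ≤ ε := fun ht hx => (infDist_le_dist_of_mem (mem_image_of_mem s ht)).trans hx
  -- By connectedness some point of the outer legs is `ε`-close to the curve both before and after
  -- `τ j`.
  obtain ⟨_, ⟨x, hx, rfl⟩, hx1, hx2⟩ := isPreconnected_closed_iff.1 hconn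
    {y | infDist y (s '' Iic (τ j)) ≤ ε} {y | infDist y (s '' Ici (τ j)) ≤ ε}
    (isClosed_le (continuous_infDist_pt _) continuous_const)
    (isClosed_le (continuous_infDist_pt _) continuous_const)
    (by
      rintro _ ⟨x, hx, rfl⟩
      obtain ⟨t, ht⟩ := hε x (hsub hx)
      rcases le_total t (τ j) with htj | htj
      · exact Or.inl (hle (I := Iic (τ j)) htj ht)
      · exact Or.inr (hle (I := Ici (τ j)) htj ht))
    ⟨_, ⟨tip i, Or.inl (tip_mem_leg i), rfl⟩, hle (I := Iic (τ j)) h1 (hτ i)⟩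
    ⟨_, ⟨tip k, Or.inr (tip_mem_leg k), rfl⟩, hle (I := Ici (τ j)) h2 (hτ k)⟩
  obtain ⟨_, ⟨a, ha, rfl⟩, hxa⟩ := (isClosed_Iic.isCompact.image s.continuous).exists_infDist_eq_dist
    ⟨_, mem_image_of_mem s (mem_Iic.2 le_rfl)⟩ (h x)
  obtain ⟨_, ⟨b, hb, rfl⟩, hxb⟩ := (isClosed_Ici.isCompact.image s.continuous).exists_infDist_eq_dist
    ⟨_, mem_image_of_mem s (mem_Ici.2 le_rfl)⟩ (h x)
  simp only [mem_ofPred_eq] at hx1 hx2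
  rw [hxa] at hx1
  rw [hxb] at hx2
  have hinf : infDist (h (tip j)) (h '' (leg i ∪ leg k)) ≤ dist (h (tip j)) (h x) :=
    infDist_le_dist_of_mem ⟨x, hx, rfl⟩
  have hLab := hL a (τ j) b ha hb
  -- Since `s a` and `s b` are `2 ε`-close, the detour through `s (τ j)` has length at most `L -
  -- dist (s 0) (s 1) + 2 ε`; its shorter half gives the estimate.
  have e1 := dist_triangle4 (s 0) (s a) (s b) (s 1)
  have e2 := dist_triangle_left (s a) (s b) (h x)
  have e3 := dist_triangle4 (h (tip j)) (s (τ j)) (s a) (h x)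
  have e4 := dist_triangle4 (h (tip j)) (s (τ j)) (s b) (h x)
  have e5 := hτ j
  rw [dist_comm (s a) (h x), dist_comm (s (τ j)) (s a)] at e3
  rw [dist_comm (s b) (h x)] at e4
  linarith

/-- A `c`-antenna in a ball forces the geodesic deviation there to be larger than `c / 7`. -/
theorem HasAntenna.lt_betaPrime {X : Set EllInfty} {c : ℝ} {x : X} {r : ℝ} (hc : 0 < c)
    (hX : HasAntenna c x r) : ENNReal.ofReal (c / 7) < betaPrime X x r := by
  obtain ⟨h, hemb, hball, hdist⟩ := hX
  -- Each curve only gives a non-strict bound, which survives the infimum; proving it with `c / 6`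
  -- leaves room for strictness at `c / 7`.
  refine lt_of_lt_of_le ((ENNReal.ofReal_lt_ofReal_iff (by positivity)).2
    (show c / 7 < c / 6 by linarith)) ?_
  refine le_iInf fun s => le_iInf fun hs => le_iInf fun hne => ?_
  have hd0 : edist (s 0) (s 1) ≠ 0 := by simpa using hne
  have hd1 : edist (s 0) (s 1) ≠ ∞ := edist_ne_top _ _
  rw [ENNReal.le_div_iff_mul_le (Or.inl hd0) (Or.inl hd1)]
  by_contra! hlt
  set V := eVariationOn s univ with hV
  set D := ⨆ z ∈ X ∩ ball (x : EllInfty) r, infEDist z (range s) with hD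
  have hdr : dist (s 0) (s 1) < 2 * r := by
    have h0 := hs 0
    have h1 := hs 1
    rw [mem_ball] at h0 h1
    linarith [dist_triangle_right (s 0) (s 1) (x : EllInfty)]
  have hlt_top : V - edist (s 0) (s 1) + D < ∞ :=
    hlt.trans (ENNReal.mul_lt_top ENNReal.ofReal_lt_top hd1.lt_top)
  obtain ⟨hVd, hDtop⟩ := ENNReal.add_ne_top.1 hlt_top.ne
  have hVtop : V ≠ ∞ := fun hVt => hVd (by rw [hVt]; exact ENNReal.top_sub hd1)
  have hdV : edist (s 0) (s 1) ≤ V := eVariationOn.edist_le s (mem_univ _) (mem_univ _)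
  have hreal : V.toReal - dist (s 0) (s 1) + D.toReal < c / 6 * dist (s 0) (s 1) := by
    have h1 := (ENNReal.toReal_lt_toReal hlt_top.ne
      (ENNReal.mul_ne_top ENNReal.ofReal_ne_top hd1)).2 hlt
    rwa [ENNReal.toReal_add hVd hDtop, ENNReal.toReal_sub_of_le hdV hVtop, ENNReal.toReal_mul,
      ENNReal.toReal_ofReal (by positivity), ← dist_edist] at h1
  have hcont : ContinuousOn (fun u => (h u : EllInfty)) tripod :=
    continuous_subtype_val.comp_continuousOn (continuousOn_of_isEmbedding_domRestrict hemb)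
  obtain ⟨i, j, k, hij, hjk, hik, hle⟩ := exists_tip_near_opposite_legs s hcont
    (L := V.toReal) (ε := D.toReal) (fun a t b hat htb => by
      have h1 := ENNReal.toReal_mono hVtop (edist_add_edist_le_eVariationOn s hat htb)
      rwa [ENNReal.toReal_add, ENNReal.toReal_add, ENNReal.toReal_add, ← dist_edist, ← dist_edist,
        ← dist_edist, ← dist_edist] at h1 <;> simp [edist_ne_top])
    (fun u hu => by
      obtain ⟨_, ⟨t, rfl⟩, ht⟩ := (isCompact_range s.continuous).exists_infEDist_eq_edist
        (range_nonempty s) (h u : EllInfty)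
      refine ⟨t, ?_⟩
      rw [dist_edist]
      refine ENNReal.toReal_mono hDtop ?_
      rw [← ht]
      exact le_iSup₂ (f := fun z (_ : z ∈ X ∩ ball (x : EllInfty) r) => infEDist z (range s))
        (h u : EllInfty) ⟨(h u).2, hball ⟨u, hu, rfl⟩⟩)
  have hcr := hdist j i k hij.symm hik hjk
  rw [← Metric.infDist_image isometry_subtype_coe, image_image] at hcr
  have hD0 : 0 ≤ D.toReal := ENNReal.toReal_nonneg
  have hV0 : dist (s 0) (s 1) ≤ V.toReal := by
    rw [dist_edist]
    exact ENNReal.toReal_mono hVtop hdV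
  -- The tip estimate is at most three times the numerator, hence less than `c / 2 * dist (s 0) (s
  -- 1) < c * r`.
  nlinarith

/-! ### Quasisymmetric images -/

section Quasisymmetric

variable {X : Type*} [MetricSpace X] {Y : Type*} [MetricSpace Y]

/-- The distortion bound of a quasisymmetric map, with an increasing gauge defined on `ℝ` that
tends to zero at zero. -/
theorem IsQuasisymmetric.exists_gauge {f : X → Y} (hf : IsQuasisymmetric f) :
    ∃ g : ℝ → ℝ, (∀ t, 0 < t → 0 < g t) ∧ (∀ ε, 0 < ε → ∃ δ, 0 < δ ∧ g δ = ε) ∧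
      ∀ (x y z : X) (t : ℝ), x ≠ y → z ≠ y → x ≠ z → dist x y ≤ t * dist z y →
        dist (f x) (f y) ≤ g t * dist (f z) (f y) := by
  obtain ⟨hinj, η, hη, H⟩ := hf
  refine ⟨fun t => if h : t ∈ Ioi (0 : ℝ) then (η ⟨t, h⟩ : ℝ) else 0, fun t ht => ?_,
    fun ε hε => ?_, ?_⟩
  · simp only [dif_pos (mem_Ioi.2 ht)]
    exact (η ⟨t, ht⟩).2
  · refine ⟨η.symm ⟨ε, hε⟩, (η.symm ⟨ε, hε⟩).2, ?_⟩
    simp only [dif_pos (η.symm ⟨ε, hε⟩).2, Subtype.coe_eta, Homeomorph.apply_symm_apply]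
  · intro x y z t hxy hzy hxz ht
    have hzy' := dist_pos.2 hzy
    have hfzy : 0 < dist (f z) (f y) := dist_pos.2 (hinj.ne hzy)
    have htd : dist x y / dist z y ≤ t := (div_le_iff₀ hzy').2 ht
    have ht0 : 0 < t := (div_pos (dist_pos.2 hxy) hzy').trans_le htd
    simp only [dif_pos (mem_Ioi.2 ht0)]
    rw [← div_le_iff₀ hfzy]
    refine (H x y z hxy hzy hxz).trans ?_
    exact_mod_cast hη.monotone (Subtype.mk_le_mk.2 htd)

/-- Distances to `f y` are compared with that of a fixed third point `z`, and the gauge takes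
arbitrarily small values. -/
theorem IsQuasisymmetric.continuous {f : X → Y} (hf : IsQuasisymmetric f) : Continuous f := by
  obtain ⟨g, hg0, hg, H⟩ := hf.exists_gauge
  rw [continuous_iff_continuousAt]
  intro y
  by_cases hy : ∃ z, z ≠ y
  · obtain ⟨z, hz⟩ := hy
    have hzy : 0 < dist z y := dist_pos.2 hz
    rw [Metric.continuousAt_iff]
    intro ε hε
    have hfz : 0 < dist (f z) (f y) := dist_pos.2 (hf.1.ne hz)
    obtain ⟨δ, hδ, hgδ⟩ := hg (ε / (2 * dist (f z) (f y))) (by positivity)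
    refine ⟨min (δ * dist z y) (dist z y), by positivity, fun x hx => ?_⟩
    rcases eq_or_ne x y with rfl | hxy
    · rwa [dist_self]
    · have h1 := H x y z δ hxy hz (fun h => by
        rw [h] at hx
        exact absurd (hx.trans_le (min_le_right _ _)) (lt_irrefl _)) (hx.le.trans (min_le_left _ _))
      rw [hgδ] at h1
      have h2 : ε / (2 * dist (f z) (f y)) * dist (f z) (f y) = ε / 2 := by
        field_simp
      linarith
  · push Not at hy
    have : f = fun _ => f y := funext fun x => by rw [hy x]
    rw [this]
    exact continuousAt_const

/-- A quasisymmetric image of an antenna-like compact space is antenna-like. -/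
theorem IsQuasisymmetric.exists_isAntennaLike_range [CompactSpace X] {f : X → Y}
    (hf : IsQuasisymmetric f) {c : ℝ} (hc : 0 < c) (hX : IsAntennaLike X c) :
    ∃ c' : ℝ, 0 < c' ∧ IsAntennaLike (range f) c' := by
  have hcont := hf.continuous
  obtain ⟨g, hg0, -, H⟩ := hf.exists_gauge
  have hg1 := hg0 (5 / c) (by positivity)
  have hg2 := hg0 (4 / 3) (by positivity)
  refine ⟨1 / (g (5 / c) * (1 + g (4 / 3))), by positivity, ?_⟩
  rintro ⟨_, x, rfl⟩ R hR hRd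
  obtain ⟨z₁, hz₁⟩ : ∃ z, R ≤ dist (f z) (f x) := by
    by_contra! hlt
    refine absurd (diam_le_of_forall_dist_le (by positivity : 0 ≤ 2 * R) ?_)
      (not_le.2 (by linarith : 2 * R < diam (univ : Set (range f))))
    rintro ⟨_, a, rfl⟩ - ⟨_, b, rfl⟩ -
    rw [Subtype.dist_eq]
    linarith [dist_triangle_right (f a) (f b) (f x), hlt a, hlt b]
  have hfar : IsCompact {z | R ≤ dist (f z) (f x)} :=
    (isClosed_le continuous_const (by fun_prop)).isCompact
  -- `z` is a nearest point to `x` among those with image outside the target ball, so `f` maps the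
  -- open ball of radius `dist z x` into that ball.
  obtain ⟨z, hz, hzmin⟩ := hfar.exists_isMinOn ⟨z₁, hz₁⟩
    (f := fun z => dist z x) (by fun_prop)
  have hz : R ≤ dist (f z) (f x) := hz
  have hzx : z ≠ x := by
    rintro rfl
    rw [dist_self] at hz
    linarith
  have hr : 0 < dist z x := dist_pos.2 hzx
  have hball : ∀ y, dist y x < dist z x → dist (f y) (f x) < R := by
    intro y hy
    by_contra! h
    exact absurd (hzmin h) (not_le.2 hy)
  have hdiam : dist z x ≤ diam (univ : Set X) :=
    dist_le_diam_of_mem isCompact_univ.isBounded (mem_univ _) (mem_univ _)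
  obtain ⟨h, hemb, hsub, hdist⟩ := hX x (dist z x / 4) (by positivity) (by linarith)
  have hsub' : ∀ u ∈ tripod, dist (h u) x < dist z x / 4 := fun u hu => hsub ⟨u, hu, rfl⟩
  have hfemb : IsEmbedding (rangeFactorization f) :=
    ((hcont.subtype_mk _).isClosedEmbedding
      fun a b hab => hf.1 (congrArg Subtype.val hab)).isEmbedding
  refine ⟨rangeFactorization f ∘ h, hfemb.comp hemb, ?_, ?_⟩
  · rintro _ ⟨u, hu, rfl⟩
    exact hball _ (by linarith [hsub' u hu])
  · intro i j k hij hjk hik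
    have hne : (rangeFactorization f ∘ h '' (leg j ∪ leg k)).Nonempty :=
      ⟨_, tip j, Or.inl (tip_mem_leg j), rfl⟩
    rw [le_infDist hne]
    rintro _ ⟨u, hu, rfl⟩
    have hut : u ∈ tripod := (union_subset (leg_subset_tripod j) (leg_subset_tripod k)) hu
    have hq := hsub' u hut
    have hp := hsub' (tip i) (leg_subset_tripod i (tip_mem_leg i))
    have hpq : c * (dist z x / 4) ≤ dist (h (tip i)) (h u) :=
      (hdist i j k hij hjk hik).trans (infDist_le_dist_of_mem ⟨u, hu, rfl⟩)
    change _ ≤ dist (f (h (tip i))) (f (h u))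
    set p := h (tip i)
    set q := h u
    have hcd : 0 < c * (dist z x / 4) := by positivity
    have hqp : q ≠ p := by
      intro he
      rw [he, dist_self] at hpq
      linarith
    have hzp : z ≠ p := by
      intro he
      rw [← he] at hp
      linarith
    have hzq : z ≠ q := by
      intro he
      rw [← he] at hq
      linarith
    -- `dist z p ≤ 5 / 4 * dist z x`, while `dist p q ≥ c / 4 * dist z x`.
    have h1 : dist (f z) (f p) ≤ g (5 / c) * dist (f q) (f p) := by
      refine H z p q _ hzp hqp hzq ?_
      have e1 := dist_triangle_right z p x
      rw [dist_comm q p]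
      have e2 : 5 / c * (c * (dist z x / 4)) ≤ 5 / c * dist p q := by gcongr
      have e3 : 5 / c * (c * (dist z x / 4)) = 5 / 4 * dist z x := by field_simp
      linarith
    -- `dist p z ≥ 3 / 4 * dist z x` explains `4 / 3`; the summand `1` covers the case `p = x`,
    -- where the gauge does not apply.
    have h2 : R ≤ (1 + g (4 / 3)) * dist (f z) (f p) := by
      rcases eq_or_ne p x with hpx | hpx
      · rw [hpx]
        nlinarith
      · have e0 : dist (f x) (f z) ≤ g (4 / 3) * dist (f p) (f z) := by
          refine H x z p _ hzx.symm hzp.symm hpx.symm ?_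
          have e1 := dist_triangle z p x
          rw [dist_comm x z, dist_comm p z]
          linarith
        rw [dist_comm (f x), dist_comm (f p)] at e0
        nlinarith [dist_nonneg (x := f z) (y := f p)]
    rw [dist_comm (f p), div_mul_eq_mul_div, one_mul, div_le_iff₀ (by positivity)]
    calc R ≤ (1 + g (4 / 3)) * dist (f z) (f p) := h2
      _ ≤ (1 + g (4 / 3)) * (g (5 / c) * dist (f q) (f p)) := by gcongr
      _ = _ := by ring

end Quasisymmetric

theorem theorem1p5 :
    (∀ X : Set EllInfty, IsCompact X → IsConnected X →
      ∀ (c : ℝ) (x : X) (r : ℝ), 0 < c → 0 < r → HasAntenna c x r →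
        ENNReal.ofReal (c / 7) < betaPrime X x r) ∧
    (∃ c₀ : ℝ, 0 < c₀ ∧
      ∀ (X : Type u) [MetricSpace X] [CompactSpace X] [ConnectedSpace X] [Nontrivial X] (c : ℝ),
        0 < c → IsAntennaLike X c →
          ENNReal.ofReal (1 + c₀ / 49 * c ^ 2) ≤ dimH (univ : Set X)) ∧
    (∀ (X : Type u) [MetricSpace X] [CompactSpace X] [ConnectedSpace X]
      (Y : Type v) [MetricSpace Y] (f : X → Y),
        IsQuasisymmetric f → (∃ c : ℝ, 0 < c ∧ IsAntennaLike X c) →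
          IsCompact (range f) ∧ IsConnected (range f) ∧
          (∃ c' : ℝ, 0 < c' ∧ IsAntennaLike (range f) c') ∧
          (Nontrivial X → 1 < dimH (range f))) := by
  refine ⟨fun X _ _ c x r hc _ h => h.lt_betaPrime hc, ⟨49 / 2 ^ 20, by norm_num, ?_⟩, ?_⟩
  · intro X _ _ _ _ c hc hX
    convert hX.le_dimH hc using 2
    ring
  · rintro X _ _ _ Y _ f hf ⟨c, hc, hX⟩
    have hcont := hf.continuous
    obtain ⟨c', hc', hY⟩ := hf.exists_isAntennaLike_range hc hX
    refine ⟨isCompact_range hcont, isConnected_range hcont, ⟨c', hc', hY⟩, fun hnt => ?_⟩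
    have : CompactSpace (range f) := isCompact_iff_compactSpace.1 (isCompact_range hcont)
    have : ConnectedSpace (range f) := isConnected_iff_connectedSpace.1 (isConnected_range hcont)
    have : Nontrivial (range f) := by
      obtain ⟨a, b, hab⟩ := exists_pair_ne X
      exact ⟨⟨_, a, rfl⟩, ⟨_, b, rfl⟩, fun h => hab (hf.1 (congrArg Subtype.val h))⟩
    have hdim : dimH (range f) = dimH (univ : Set (range f)) := by
      rw [← isometry_subtype_coe.dimH_image univ, image_univ, Subtype.range_coe]
    rw [hdim]
    refine lt_of_lt_of_le ?_ (hY.le_dimH hc')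
    rw [← ENNReal.ofReal_one, ENNReal.ofReal_lt_ofReal_iff (by positivity)]
    linarith [show 0 < c' ^ 2 / 2 ^ 20 by positivity]
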